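/- Let $0<\beta<1$, $a_0,a_1\in\mathbb R$ and let $f\in L^2(0,1)$ satisfy $\int_0^1 f\,dx+a_1-a_0=0$. Put $${}_0I_x^{\alpha}w(x)=\frac1{\Gamma(\alpha)}\int_0^x\frac{w(s)}{(x-s)^{1-\alpha}}\,ds,\qquad {}_xI_1^{\alpha}w(x)=\frac1{\Gamma(\alpha)}\int_x^1\frac{w(s)}{(s-x)^{1-\alpha}}\,ds ,$$ and for $0<\mu<1$ let ${}^R_0D_x^{\mu}v=D\,{}_0I_x^{1-\mu}v$, ${}^C_0D_x^{\mu}v={}_0I_x^{1-\mu}Dv$ and ${}^C_xD_1^{\mu}v={}_xI_1^{1-\mu}(-Dv)$ be the left Riemann--Liouville and the left and right Caputo derivatives, with $D$ the distributional derivative on $(0,1)$; the relations ${}^C_0D_x^{\mu}v=g$ and ${}^C_xD_1^{\mu}v=h$ mean $Dv=D\,{}_0I_x^{\mu}g$ and $Dv=D\,{}_xI_1^{\mu}h$ in the sense of distributions. For $1/2<\mu<1$ let $H^{\mu}_{R,l}(0,1)$ and $H^{\mu}_{C,l}(0,1)$ be the spaces of $v\in L^2(0,1)$ with ${}^R_0D_x^{\mu}v\in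 L^2(0,1)$ and ${}^C_0D_x^{\mu}v\in L^2(0,1)$, respectively. Elements of $H^{\mu}_{C,l}(0,1)$ are identified with their continuous representatives on $[0,1]$. Consider the Riemann--Liouville equation with the Caputo fractional Neumann condition, $$-D^2\,{}_0I_x^{\beta}u=f\ \text{ in }(0,1),\qquad {}^C_0D_x^{1-\beta}u\big|_{x=0}=a_0,\quad {}^C_0D_x^{1-\beta}u\big|_{x=1}=a_1 .$$ A function $u$ is a weak solution (D) in the distributional sense, if $u\in L^1(0,1)$, the equation holds in the sense of distributions on $(0,1)$, and ${}^C_0D_x^{1-\beta}u$ exists, is continuous on $[0,1]$, and takes the values $a_0$ at $0$ and $a_1$ at $1$; (G) in the Galerkin sense, if $u\in H^{1-\beta/2}_{C,l}(0,1)\cap H^{1-\beta/2}_{R,l}(0,1)$ and $$-\big({}^R_0D_x^{1-\beta/2}u,\ {}^C_xD_1^{1-\beta/2}v\big)_{L^2(0,1)}=(f,v)_{L^2(0,1)}+a_1v(1)-a_0v(0)$$ for all $v\in H^{1-\beta/2}_{C,l}(0,1)$ with ${}^C_xD_1^{1-\beta/2}v\in L^2(0,1)$. Then there is a function $u\in H^{1-\beta/2}_{C,l}(0,1)\cap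 H^{1-\beta/2}_{R,l}(0,1)$, continuous on $[0,1]$ with $u(0)=0$, which is a weak solution in both senses, and every weak solution in the sense (D) and every weak solution in the sense (G) equals $u$ almost everywhere in $(0,1)$. -/

import Mathlib

open MeasureTheory Set
open scoped ContDiff

namespace FracNeumann

/-- Lebesgue measure on the interval `(0,1)`. -/
noncomputable def unitMeasure : Measure ℝ := volume.restrict (Ioo (0 : ℝ) 1)

/-- Left fractional integral `₀I_x^α w (x) = Γ(α)⁻¹ ∫_0^x w(s) (x-s)^(α-1) ds`. -/
noncomputable def leftFracInt (α : ℝ) (w : ℝ → ℝ) (x : ℝ) : ℝ :=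
  1 / Real.Gamma α * ∫ s in (0 : ℝ)..x, w s / (x - s) ^ (1 - α)

/-- Right fractional integral `ₓI_1^α w (x) = Γ(α)⁻¹ ∫_x^1 w(s) (s-x)^(α-1) ds`. -/
noncomputable def rightFracInt (α : ℝ) (w : ℝ → ℝ) (x : ℝ) : ℝ :=
  1 / Real.Gamma α * ∫ s in x..(1 : ℝ), w s / (s - x) ^ (1 - α)

/-- The test functions `C_0^∞(0,1)`. -/
def IsTestFunction (φ : ℝ → ℝ) : Prop :=
  ContDiff ℝ ∞ φ ∧ HasCompactSupport φ ∧ tsupport φ ⊆ Ioo (0 : ℝ) 1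

/-- `g` is the left Riemann–Liouville derivative `D (₀I_x^(1-μ) v)` of order `μ` of `v`, with `D`
the distributional derivative on `(0,1)`. -/
def HasLeftRL (μ : ℝ) (v g : ℝ → ℝ) : Prop :=
  ∀ φ : ℝ → ℝ, IsTestFunction φ →
    ∫ x in (0 : ℝ)..1, leftFracInt (1 - μ) v x * deriv φ x = -∫ x in (0 : ℝ)..1, g x * φ x

/-- `g` is the left Caputo derivative `₀I_x^(1-μ) (D v)` of order `μ` of `v`, where `D v` is the
distributional derivative of `v` on `(0,1)`. Since `D ₀I_x^μ` inverts `₀I_x^(1-μ)`, the relation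
`₀I_x^(1-μ) (D v) = g` is read as `D v = D (₀I_x^μ g)` in the sense of distributions, so that
`D v` need not be a function. (It is used below for `g ∈ L²`, `μ > 1/2`, and for continuous `g`,
`0 < μ < 1`; in both cases `g` is unique.) -/
def HasLeftCaputo (μ : ℝ) (v g : ℝ → ℝ) : Prop :=
  ∀ φ : ℝ → ℝ, IsTestFunction φ →
    ∫ x in (0 : ℝ)..1, v x * deriv φ x = ∫ x in (0 : ℝ)..1, leftFracInt μ g x * deriv φ x

/-- `h` is the right Caputo derivative `ₓI_1^(1-μ) (-D v)` of order `μ` of `v`: likewise, since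
`-D ₓI_1^μ` inverts `ₓI_1^(1-μ)`, this is read as `-D v = -D (ₓI_1^μ h)` in the sense of
distributions on `(0,1)`. -/
def HasRightCaputo (μ : ℝ) (v h : ℝ → ℝ) : Prop :=
  ∀ φ : ℝ → ℝ, IsTestFunction φ →
    ∫ x in (0 : ℝ)..1, v x * deriv φ x = ∫ x in (0 : ℝ)..1, rightFracInt μ h x * deriv φ x

/-- `v ∈ H^μ_{R,l}(0,1)`, for `1/2 < μ < 1`: `v ∈ L²` and its left Riemann–Liouville derivative of
order `μ` is in `L²`. -/
def MemHRl (μ : ℝ) (v : ℝ → ℝ) : Prop :=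
  MemLp v 2 unitMeasure ∧ ∃ g : ℝ → ℝ, MemLp g 2 unitMeasure ∧ HasLeftRL μ v g

/-- `v ∈ H^μ_{C,l}(0,1)`, for `1/2 < μ < 1`: `v ∈ L²` and its left Caputo derivative of
order `μ` is in `L²`. -/
def MemHCl (μ : ℝ) (v : ℝ → ℝ) : Prop :=
  MemLp v 2 unitMeasure ∧ ∃ g : ℝ → ℝ, MemLp g 2 unitMeasure ∧ HasLeftCaputo μ v g

/-- Weak (distributional) solutions of `- D² (₀I_x^β u) = f` on `(0,1)` whose left Caputo derivative
of order `1-β` has the boundary values `a₀` at `0` and `a₁` at `1`. No regularity beyond `u ∈ L¹`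
and the existence of a Caputo derivative with boundary values is required. -/
structure IsDistribSolution (β : ℝ) (f : ℝ → ℝ) (a₀ a₁ : ℝ) (u : ℝ → ℝ) : Prop where
  integrable : Integrable u unitMeasure
  equation : ∀ φ : ℝ → ℝ, IsTestFunction φ →
    -∫ x in (0 : ℝ)..1, leftFracInt β u x * deriv (deriv φ) x = ∫ x in (0 : ℝ)..1, f x * φ x
  boundary : ∃ g : ℝ → ℝ, ContinuousOn g (Icc 0 1) ∧ HasLeftCaputo (1 - β) u g ∧
    g 0 = a₀ ∧ g 1 = a₁

/-- Weak solutions of the same problem in the sense of the Galerkin formulation: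
`u ∈ H^{1-β/2}_{C,l} ∩ H^{1-β/2}_{R,l}` and
`-(ᴿ₀D_x^(1-β/2) u, ᶜₓD_1^(1-β/2) v)_{L²} = (f, v) + a₁ v(1) - a₀ v(0)` for all
`v ∈ H^{1-β/2}_{C,l}`. The elements `v` are represented by their continuous representatives;
`h` is the right Caputo derivative of `v`. -/
structure IsGalerkinSolution (β : ℝ) (f : ℝ → ℝ) (a₀ a₁ : ℝ) (u : ℝ → ℝ) : Prop where
  memHCl : MemHCl (1 - β / 2) u
  memHRl : MemHRl (1 - β / 2) u
  equation : ∀ r : ℝ → ℝ, MemLp r 2 unitMeasure → HasLeftRL (1 - β / 2) u r →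
    ∀ v : ℝ → ℝ, ContinuousOn v (Icc 0 1) → MemHCl (1 - β / 2) v →
    ∀ h : ℝ → ℝ, MemLp h 2 unitMeasure → HasRightCaputo (1 - β / 2) v h →
      -∫ x in (0 : ℝ)..1, r x * h x = (∫ x in (0 : ℝ)..1, f x * v x) + a₁ * v 1 - a₀ * v 0

end FracNeumann

/-!
Write `μ = 1 - β/2`, `I^α = ₀I_x^α`, `F = I^1 f`, and `κ_α = t^(α-1)/Γ(α)` for the kernel of `I^α`.

*Existence.* The solution is `u = I^(1-β) (a₀ - F)`: its Caputo derivative of order `1 - β` is the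
continuous function `a₀ - F`, which is `a₀` at `0` and, by the compatibility condition, `a₁` at `1`;
and `I^β u = I^1 (a₀ - F)`, so that `-D² I^β u = f`. Since `1 = I^(1-μ) κ_μ` and
`F = I^(1-μ) I^μ f`, the semigroup law also gives `u = I^μ k` with `k = a₀ κ_μ - I^μ f`
(`neumannSolution_ae_eq`). As `μ > 1/2`, the kernel `κ_μ` and hence `k` are in `L²`, a convolution
of two `L²` functions is continuous, and `k` is both the Caputo and the Riemann–Liouville derivative
of order `μ` of `u`. An admissible `v` with right Caputo derivative `h` is `ₓI_1^μ h + v(1)`, and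
Fubini's theorem turns `∫ k h` into the right-hand side of the Galerkin equation
(`neumannFlux_galerkin`).

*Uniqueness.* By the lemma of du Bois-Reymond (`exists_ae_eq_add_const`) a function with Caputo
derivative `g` of order `ν` is `I^ν g + c`, and then `D I^(1-ν)` of it is `g + c κ_(1-ν)`
(`leftFracInt_ae_eq_leftFracInt_one`). Under either notion of solution the constant `c` vanishes
because the kernel is too singular at `0`: in the distributional case `ν = 1 - β` and `c κ_β` would
be continuous up to `0`, in the Galerkin case `ν = μ` and `c κ_(β/2)` would be in `L²`. It remains to
identify `g`. In the distributional case `g + F` is constant and `g 0 = a₀`. In the Galerkin case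
testing with `v = ₓI_1^1 ψ`, `h = ₓI_1^(1-μ) ψ` shows that `I^(1-μ) (g - k)` vanishes, and fractional
integration is injective.
-/

namespace FracNeumann

open scoped Convolution

/-! ### The fractional integral as a convolution -/

/-- The convolution kernel `t ↦ t^(α-1) / Γ(α)` of the fractional integral of order `α`, cut off to
`(0,1)`: only these values of `t = x - s` occur for `x, s ∈ (0,1)`, and the cut-off makes the kernel
integrable on all of `ℝ`. -/
noncomputable def fracKernel (α : ℝ) : ℝ → ℝ :=
  (Ioo (0 : ℝ) 1).indicator fun t => t ^ (α - 1) / Real.Gamma α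

lemma fracKernel_of_mem {α t : ℝ} (ht : t ∈ Ioo (0 : ℝ) 1) :
    fracKernel α t = t ^ (α - 1) / Real.Gamma α := indicator_of_mem ht _

lemma fracKernel_of_nonpos {α t : ℝ} (ht : t ≤ 0) : fracKernel α t = 0 :=
  indicator_of_notMem (fun h => absurd h.1 ht.not_gt) _

lemma integral_zero_one_eq (w : ℝ → ℝ) : ∫ x in (0 : ℝ)..1, w x = ∫ x, w x ∂unitMeasure := by
  rw [intervalIntegral.integral_of_le zero_le_one, integral_Ioc_eq_integral_Ioo, unitMeasure]

lemma ae_unitMeasure_mem : ∀ᵐ x ∂unitMeasure, x ∈ Ioo (0 : ℝ) 1 :=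
  ae_restrict_mem measurableSet_Ioo

instance : IsProbabilityMeasure unitMeasure := ⟨by simp [unitMeasure]⟩

lemma integrable_unitMeasure_iff {w : ℝ → ℝ} :
    Integrable w unitMeasure ↔ Integrable ((Ioo (0 : ℝ) 1).indicator w) volume :=
  (integrable_indicator_iff measurableSet_Ioo).symm

lemma integrable_rpow_unitMeasure {γ : ℝ} (hγ : -1 < γ) :
    Integrable (fun t : ℝ => t ^ γ) unitMeasure := by
  have := (intervalIntegral.intervalIntegrable_rpow' hγ (a := 0) (b := 1))
  rw [intervalIntegrable_iff_integrableOn_Ioo_of_le zero_le_one] at this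
  exact this

lemma integrable_fracKernel {α : ℝ} (hα : 0 < α) : Integrable (fracKernel α) volume :=
  integrable_unitMeasure_iff.1 ((integrable_rpow_unitMeasure (by linarith)).div_const _)

lemma leftFracInt_eq_convolution {α : ℝ} {w : ℝ → ℝ} {x : ℝ} (hx : x ∈ Icc (0 : ℝ) 1) :
    leftFracInt α w x =
      ((Ioo (0 : ℝ) 1).indicator w ⋆[ContinuousLinearMap.mul ℝ ℝ, volume] fracKernel α) x := by
  rw [leftFracInt, convolution, intervalIntegral.integral_of_le hx.1, integral_Ioc_eq_integral_Ioo,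
    ← integral_const_mul, ← integral_indicator measurableSet_Ioo]
  congr 1
  ext s
  simp only [ContinuousLinearMap.mul_apply', indicator, fracKernel, mem_Ioo]
  by_cases hs : 0 < s ∧ s < x
  · have h1 : 0 < s ∧ s < 1 := ⟨hs.1, hs.2.trans_le hx.2⟩
    have h2 : 0 < x - s ∧ x - s < 1 := ⟨by linarith, by linarith [hx.2]⟩
    rw [if_pos hs, if_pos h1, if_pos h2, ← neg_sub α 1, Real.rpow_neg h2.1.le]
    simp only [div_eq_mul_inv, inv_inv]; ring
  · rw [if_neg hs]
    by_cases h1 : 0 < s ∧ s < 1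
    · rw [if_pos h1, if_neg (fun h2 => hs ⟨h1.1, by linarith [h2.1]⟩), mul_zero]
    · rw [if_neg h1, zero_mul]

lemma rightFracInt_eq_leftFracInt (α : ℝ) (w : ℝ → ℝ) (x : ℝ) :
    rightFracInt α w x = leftFracInt α (fun s => w (1 - s)) (1 - x) := by
  rw [rightFracInt, leftFracInt]
  congr 1
  have := intervalIntegral.integral_comp_sub_left
    (fun s => w s / (s - x) ^ (1 - α)) (1 : ℝ) (a := 0) (b := 1 - x)
  simp only [sub_zero, sub_sub_cancel] at this
  rw [← this]
  congr 1; ext s; congr 2; ring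

lemma leftFracInt_congr {α : ℝ} {v w : ℝ → ℝ} (h : v =ᵐ[unitMeasure] w) {x : ℝ}
    (hx : x ∈ Icc (0 : ℝ) 1) : leftFracInt α v x = leftFracInt α w x := by
  rw [leftFracInt, leftFracInt, intervalIntegral.integral_of_le hx.1,
    intervalIntegral.integral_of_le hx.1, integral_Ioc_eq_integral_Ioo,
    integral_Ioc_eq_integral_Ioo]
  congr 1
  have h' : v =ᵐ[volume.restrict (Ioo 0 x)] w :=
    ae_restrict_of_ae_restrict_of_subset (Ioo_subset_Ioo_right hx.2) h
  exact integral_congr_ae (h'.mono fun s hs => by simp [hs])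

lemma integrable_leftFracInt {α : ℝ} (hα : 0 < α) {w : ℝ → ℝ} (hw : Integrable w unitMeasure) :
    Integrable (leftFracInt α w) unitMeasure := by
  have := (integrable_unitMeasure_iff.1 hw).integrable_convolution (ContinuousLinearMap.mul ℝ ℝ)
    (integrable_fracKernel hα)
  refine (this.restrict (s := Ioo 0 1)).congr ?_
  filter_upwards [ae_unitMeasure_mem] with x hx
  exact (leftFracInt_eq_convolution (Ioo_subset_Icc_self hx)).symm

/-- The integrals defining `leftFracInt α w` converge at almost every point. -/
lemma ae_integrable_leftFracInt {α : ℝ} (hα : 0 < α) {w : ℝ → ℝ}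
    (hw : Integrable w unitMeasure) :
    ∀ᵐ x ∂unitMeasure, Integrable (fun s => (Ioo (0 : ℝ) 1).indicator w s * fracKernel α (x - s)) :=
  ae_restrict_of_ae ((integrable_unitMeasure_iff.1 hw).ae_convolution_exists
    (ContinuousLinearMap.mul ℝ ℝ) (integrable_fracKernel hα))

lemma leftFracInt_linear {α : ℝ} (hα : 0 < α) {v w : ℝ → ℝ} (hv : Integrable v unitMeasure)
    (hw : Integrable w unitMeasure) (a b : ℝ) :
    leftFracInt α (fun s => a * v s + b * w s) =ᵐ[unitMeasure]
      fun x => a * leftFracInt α v x + b * leftFracInt α w x := by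
  filter_upwards [ae_unitMeasure_mem, ae_integrable_leftFracInt hα hv,
    ae_integrable_leftFracInt hα hw] with x hx h1 h2
  have hx' := Ioo_subset_Icc_self hx
  rw [leftFracInt_eq_convolution hx', leftFracInt_eq_convolution hx',
    leftFracInt_eq_convolution hx', convolution, convolution, convolution]
  simp only [ContinuousLinearMap.mul_apply']
  rw [← integral_const_mul, ← integral_const_mul, ← integral_add (h1.const_mul a) (h2.const_mul b)]
  congr 1; ext s
  by_cases hs : s ∈ Ioo (0 : ℝ) 1
  · simp only [indicator_of_mem hs]; ring
  · simp [indicator_of_notMem hs]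

/-! ### The semigroup law -/

/-- Euler's Beta integral in terms of the kernels: the fractional integral of order `α` of the
kernel of order `β` is the kernel of order `α + β`. -/
lemma leftFracInt_fracKernel {α β : ℝ} (hα : 0 < α) (hβ : 0 < β) {x : ℝ} (hx : x ∈ Ioo (0 : ℝ) 1) :
    leftFracInt α (fracKernel β) x = fracKernel (α + β) x := by
  have h := Complex.betaIntegral_scaled (β : ℂ) (α : ℂ) hx.1
  rw [Complex.betaIntegral_eq_Gamma_mul_div _ _ (by simpa) (by simpa), ← Complex.ofReal_add,
    Complex.Gamma_ofReal, Complex.Gamma_ofReal, Complex.Gamma_ofReal] at h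
  have hi : ∫ s in (0 : ℝ)..x, s ^ (β - 1) * (x - s) ^ (α - 1) =
      x ^ (β + α - 1) * (Real.Gamma β * Real.Gamma α / Real.Gamma (β + α)) := by
    apply Complex.ofReal_injective
    rw [← intervalIntegral.integral_ofReal]
    push_cast
    rw [Complex.ofReal_cpow hx.1.le]
    push_cast at h ⊢
    rw [← h, intervalIntegral.integral_of_le hx.1.le, intervalIntegral.integral_of_le hx.1.le]
    refine setIntegral_congr_fun measurableSet_Ioc fun s hs => ?_
    rw [Complex.ofReal_cpow hs.1.le, Complex.ofReal_cpow (by linarith [hs.2])]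
    push_cast; rfl
  have hΓα := (Real.Gamma_pos_of_pos hα).ne'
  have hΓβ := (Real.Gamma_pos_of_pos hβ).ne'
  have hΓ := (Real.Gamma_pos_of_pos (add_pos hα hβ)).ne'
  have hk : ∫ s in (0 : ℝ)..x, fracKernel β s / (x - s) ^ (1 - α) =
      (∫ s in (0 : ℝ)..x, s ^ (β - 1) * (x - s) ^ (α - 1)) / Real.Gamma β := by
    rw [← intervalIntegral.integral_div, intervalIntegral.integral_of_le hx.1.le,
      intervalIntegral.integral_of_le hx.1.le]
    refine setIntegral_congr_fun measurableSet_Ioc fun s hs => ?_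
    rw [fracKernel_of_mem ⟨hs.1, hs.2.trans_lt hx.2⟩, div_eq_mul_inv (_ / _),
      ← Real.rpow_neg (by linarith [hs.2]), neg_sub]
    ring
  rw [leftFracInt, hk, hi, fracKernel_of_mem hx, add_comm β α]
  field_simp

lemma leftFracInt_leftFracInt {α β : ℝ} (hα : 0 < α) (hβ : 0 < β) {w : ℝ → ℝ}
    (hw : Integrable w unitMeasure) :
    leftFracInt α (leftFracInt β w) =ᵐ[unitMeasure] leftFracInt (α + β) w := by
  set L := ContinuousLinearMap.mul ℝ ℝ
  set W := (Ioo (0 : ℝ) 1).indicator w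
  have hW : Integrable W := integrable_unitMeasure_iff.1 hw
  have hkα := integrable_fracKernel hα
  have hkβ := integrable_fracKernel hβ
  have hex : ∀ᵐ x ∂(volume : Measure ℝ), ConvolutionExistsAt (fun x => ‖W x‖)
      ((fun x => ‖fracKernel β x‖) ⋆[L, volume] fun x => ‖fracKernel α x‖) x L volume :=
    hW.norm.ae_convolution_exists L (hkβ.norm.integrable_convolution L hkα.norm)
  filter_upwards [ae_unitMeasure_mem, ae_restrict_of_ae hex] with x hx hexx
  have hx' := Ioo_subset_Icc_self hx
  have hassoc := convolution_assoc L L L L (x₀ := x) (fun a b c => mul_assoc a b c)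
    hW.aestronglyMeasurable hkβ.aestronglyMeasurable hkα.aestronglyMeasurable
    (hW.ae_convolution_exists L hkβ) (hkβ.norm.ae_convolution_exists L hkα.norm) hexx
  rw [leftFracInt_eq_convolution hx', leftFracInt_eq_convolution hx']
  trans ((W ⋆[L, volume] fracKernel β) ⋆[L, volume] fracKernel α) x
  · simp only [convolution]
    congr 1; ext s
    by_cases hs : s ∈ Ioo (0 : ℝ) 1
    · rw [indicator_of_mem hs, leftFracInt_eq_convolution (Ioo_subset_Icc_self hs)]; rfl
    · rw [indicator_of_notMem hs]
      by_cases hs0 : s ≤ 0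
      · -- for `s ≤ 0` one factor of the inner integrand vanishes at every point
        have : ∀ t, W t * fracKernel β (s - t) = 0 := by
          intro t
          by_cases ht : t ∈ Ioo (0 : ℝ) 1
          · rw [fracKernel_of_nonpos (by linarith [ht.1]), mul_zero]
          · simp [W, indicator_of_notMem ht]
        simp [L, this]
      · have : 1 ≤ s := by by_contra h1; exact hs ⟨not_le.1 hs0, not_le.1 h1⟩
        rw [fracKernel_of_nonpos (by linarith [hx.2])]; simp
  · rw [hassoc, convolution, convolution]
    congr 1; ext s
    by_cases hs : s ∈ Ioo (0 : ℝ) 1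
    · congr 1
      by_cases hxs : 0 < x - s
      · have hmem : x - s ∈ Ioo (0 : ℝ) 1 := ⟨hxs, by linarith [hx.2, hs.1]⟩
        rw [← leftFracInt_fracKernel hα hβ hmem,
          leftFracInt_eq_convolution (Ioo_subset_Icc_self hmem)]
        congr 1
        exact (indicator_eq_self.2 support_indicator_subset).symm
      · rw [fracKernel_of_nonpos (not_lt.1 hxs), convolution]
        have : ∀ t, fracKernel β t * fracKernel α (x - s - t) = 0 := by
          intro t
          by_cases ht : t ≤ 0
          · rw [fracKernel_of_nonpos ht, zero_mul]
          · rw [fracKernel_of_nonpos (show x - s - t ≤ 0 by linarith), mul_zero]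
        simp [L, this]
    · simp [W, indicator_of_notMem hs]

/-! ### Continuity of fractional integrals of square-integrable functions -/

lemma memLp_fracKernel {α : ℝ} (hα : 1 / 2 < α) : MemLp (fracKernel α) 2 volume := by
  rw [memLp_two_iff_integrable_sq (integrable_fracKernel (by linarith)).aestronglyMeasurable]
  have h : Integrable (fun t : ℝ => t ^ (2 * α - 2) / Real.Gamma α ^ 2) unitMeasure :=
    (integrable_rpow_unitMeasure (by linarith)).div_const _
  refine (integrable_unitMeasure_iff.1 h).congr (Filter.Eventually.of_forall fun t => ?_)
  by_cases ht : t ∈ Ioo (0 : ℝ) 1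
  · simp only
    rw [indicator_of_mem ht, fracKernel_of_mem ht, div_pow, ← Real.rpow_mul_natCast ht.1.le]
    congr 2; push_cast; ring
  · simp [fracKernel, indicator_of_notMem ht]

lemma memLp_unitMeasure_iff {w : ℝ → ℝ} :
    MemLp w 2 unitMeasure ↔ MemLp ((Ioo (0 : ℝ) 1).indicator w) 2 volume :=
  (memLp_indicator_iff_restrict measurableSet_Ioo).symm

/-- The convolution of two square-integrable functions is continuous, because translation is
continuous in `L²`. -/
lemma continuous_convolution_of_memLp {f g : ℝ → ℝ} (hf : MemLp f 2 volume)
    (hg : MemLp g 2 volume) :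
    Continuous (f ⋆[ContinuousLinearMap.mul ℝ ℝ, volume] g) := by
  let T : ℝ → C(ℝ, ℝ) := fun x => ⟨fun t => x - t, by fun_prop⟩
  have hT : Continuous T := ContinuousMap.continuous_of_continuous_uncurry _
    (continuous_fst.sub continuous_snd)
  have hTm : ∀ x, MeasurePreserving (T x) volume volume :=
    fun x => Measure.measurePreserving_sub_left volume x
  have hc : Continuous fun x => inner ℝ (hf.toLp f)
      (Lp.compMeasurePreserving (T x) (hTm x) (hg.toLp g)) :=
    continuous_const.inner (Continuous.compMeasurePreservingLp continuous_const hT hTm (by simp))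
  refine hc.congr fun x => ?_
  rw [L2.inner_def, convolution]
  refine integral_congr_ae ?_
  rw [Lp.toLp_compMeasurePreserving]
  filter_upwards [hf.coeFn_toLp, (hg.comp_measurePreserving (hTm x)).coeFn_toLp] with t h1 h2
  rw [h1, h2]
  simp [T, mul_comm]

lemma continuousOn_leftFracInt {α : ℝ} (hα : 1 / 2 < α) {w : ℝ → ℝ}
    (hw : MemLp w 2 unitMeasure) : ContinuousOn (leftFracInt α w) (Icc 0 1) :=
  (continuous_convolution_of_memLp (memLp_unitMeasure_iff.1 hw)
    (memLp_fracKernel hα)).continuousOn.congr fun _ hx => leftFracInt_eq_convolution hx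

lemma measurePreserving_one_sub :
    MeasurePreserving (fun x : ℝ => 1 - x) unitMeasure unitMeasure := by
  have h := (Measure.measurePreserving_sub_left volume (1 : ℝ)).restrict_preimage
    (s := Ioo (0 : ℝ) 1) measurableSet_Ioo
  have hs : (fun x : ℝ => 1 - x) ⁻¹' Ioo 0 1 = Ioo 0 1 := by
    ext x; simp only [mem_preimage, mem_Ioo]; constructor <;> rintro ⟨h1, h2⟩ <;>
      constructor <;> linarith
  rwa [hs] at h

lemma continuousOn_rightFracInt {α : ℝ} (hα : 1 / 2 < α) {w : ℝ → ℝ}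
    (hw : MemLp w 2 unitMeasure) : ContinuousOn (rightFracInt α w) (Icc 0 1) := by
  have h := continuousOn_leftFracInt hα (hw.comp_measurePreserving measurePreserving_one_sub)
  have hr : MapsTo (fun x : ℝ => 1 - x) (Icc 0 1) (Icc 0 1) := fun x hx =>
    ⟨by linarith [hx.2], by linarith [hx.1]⟩
  exact (h.comp (by fun_prop) hr).congr fun x _ => rightFracInt_eq_leftFracInt α w x

lemma memLp_of_continuousOn {w : ℝ → ℝ} (hw : ContinuousOn w (Icc 0 1)) :
    MemLp w 2 unitMeasure := by
  obtain ⟨C, hC⟩ := isCompact_Icc.exists_bound_of_continuousOn hw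
  refine MemLp.of_bound ((hw.mono Ioo_subset_Icc_self).aestronglyMeasurable measurableSet_Ioo) C ?_
  filter_upwards [ae_unitMeasure_mem] with x hx using hC x (Ioo_subset_Icc_self hx)

lemma integrable_of_memLp {w : ℝ → ℝ} (hw : MemLp w 2 unitMeasure) : Integrable w unitMeasure :=
  hw.integrable (by norm_num)

lemma integrable_mul_of_memLp {v w : ℝ → ℝ} (hv : MemLp v 2 unitMeasure)
    (hw : MemLp w 2 unitMeasure) : Integrable (fun x => v x * w x) unitMeasure :=
  hv.integrable_mul hw

/-! ### Duality between the left and the right fractional integral -/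

lemma rightFracInt_rightFracInt {α β : ℝ} (hα : 0 < α) (hβ : 0 < β) {w : ℝ → ℝ}
    (hw : Integrable w unitMeasure) :
    rightFracInt α (rightFracInt β w) =ᵐ[unitMeasure] rightFracInt (α + β) w := by
  have h := leftFracInt_leftFracInt hα hβ
    (measurePreserving_one_sub.integrable_comp_of_integrable hw)
  have h' := measurePreserving_one_sub.quasiMeasurePreserving.ae h
  filter_upwards [h'] with x hx
  rw [rightFracInt_eq_leftFracInt, rightFracInt_eq_leftFracInt (α + β)]
  refine Eq.trans ?_ hx
  congr 1; ext s
  rw [rightFracInt_eq_leftFracInt, sub_sub_cancel]; rfl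

lemma rightFracInt_eq_integral {α : ℝ} {w : ℝ → ℝ} {s : ℝ} (hs : s ∈ Icc (0 : ℝ) 1) :
    rightFracInt α w s = ∫ x, fracKernel α (x - s) * (Ioo (0 : ℝ) 1).indicator w x := by
  have hs' : 1 - s ∈ Icc (0 : ℝ) 1 := ⟨by linarith [hs.2], by linarith [hs.1]⟩
  rw [rightFracInt_eq_leftFracInt, leftFracInt_eq_convolution hs', convolution,
    ← integral_sub_left_eq_self _ volume (1 : ℝ)]
  congr 1; ext x
  have hi : (Ioo (0 : ℝ) 1).indicator (fun s => w (1 - s)) (1 - x) =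
      (Ioo (0 : ℝ) 1).indicator w x := by
    simp only [indicator, mem_Ioo, sub_sub_cancel]
    congr 1
    rw [eq_iff_iff]; constructor <;> rintro ⟨h1, h2⟩ <;> constructor <;> linarith
  simp only [ContinuousLinearMap.mul_apply', hi]
  rw [mul_comm]; congr 2; ring

/-- Fubini's theorem turns a left fractional integral into a right one. -/
lemma integral_leftFracInt_mul {α : ℝ} {w φ : ℝ → ℝ}
    (hi : Integrable (fun p : ℝ × ℝ => (Ioo (0 : ℝ) 1).indicator w p.2 * fracKernel α (p.1 - p.2) *
      (Ioo (0 : ℝ) 1).indicator φ p.1) (volume.prod volume)) :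
    ∫ x, leftFracInt α w x * φ x ∂unitMeasure = ∫ s, w s * rightFracInt α φ s ∂unitMeasure := by
  rw [unitMeasure, ← integral_indicator measurableSet_Ioo, ← integral_indicator measurableSet_Ioo]
  trans ∫ x, ∫ s, (Ioo (0 : ℝ) 1).indicator w s * fracKernel α (x - s) *
      (Ioo (0 : ℝ) 1).indicator φ x
  · congr 1; ext x
    rw [integral_mul_const]
    by_cases hx : x ∈ Ioo (0 : ℝ) 1
    · rw [indicator_of_mem hx, indicator_of_mem hx,
        leftFracInt_eq_convolution (Ioo_subset_Icc_self hx)]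
      rfl
    · simp [indicator_of_notMem hx]
  · rw [integral_integral_swap hi]
    congr 1; ext s
    by_cases hs : s ∈ Ioo (0 : ℝ) 1
    · rw [indicator_of_mem hs, indicator_of_mem hs,
        rightFracInt_eq_integral (Ioo_subset_Icc_self hs), ← integral_const_mul]
      congr 1; ext x; ring
    · simp [indicator_of_notMem hs]

lemma integral_leftFracInt_mul_of_continuousOn {α : ℝ} (hα : 0 < α) {w φ : ℝ → ℝ}
    (hw : Integrable w unitMeasure) (hφ : ContinuousOn φ (Icc 0 1)) :
    ∫ x, leftFracInt α w x * φ x ∂unitMeasure = ∫ s, w s * rightFracInt α φ s ∂unitMeasure := by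
  refine integral_leftFracInt_mul ?_
  obtain ⟨C, hC⟩ := isCompact_Icc.exists_bound_of_continuousOn hφ
  have h1 := (integrable_unitMeasure_iff.1 hw).convolution_integrand
    (ContinuousLinearMap.mul ℝ ℝ) (integrable_fracKernel hα)
  have h2 := (integrable_unitMeasure_iff.1
    (integrable_of_memLp (memLp_of_continuousOn hφ))).aestronglyMeasurable
  refine h1.mul_bdd (c := max C 0) h2.comp_fst (Filter.Eventually.of_forall fun p => ?_)
  by_cases hp : p.1 ∈ Ioo (0 : ℝ) 1
  · rw [indicator_of_mem hp]; exact (hC _ (Ioo_subset_Icc_self hp)).trans (le_max_left _ _)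
  · rw [indicator_of_notMem hp, norm_zero]; exact le_max_right _ _

lemma integral_leftFracInt_mul_of_memLp {α : ℝ} (hα : 0 < α) {w φ : ℝ → ℝ}
    (hw : MemLp w 2 unitMeasure) (hφ : MemLp φ 2 unitMeasure) :
    ∫ x, leftFracInt α w x * φ x ∂unitMeasure = ∫ s, w s * rightFracInt α φ s ∂unitMeasure := by
  refine integral_leftFracInt_mul ?_
  have hW := memLp_unitMeasure_iff.1 hw
  have hΦ := memLp_unitMeasure_iff.1 hφ
  have hk := integrable_fracKernel hα
  -- `|w k φ| ≤ k w² + k φ²`, and both terms on the right are convolution integrands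
  have h1 := hW.integrable_sq.convolution_integrand (ContinuousLinearMap.mul ℝ ℝ) hk
  have h2 : Integrable (fun p : ℝ × ℝ => (Ioo (0 : ℝ) 1).indicator φ p.1 ^ 2 *
      fracKernel α (p.1 - p.2)) (volume.prod volume) := by
    have := (hΦ.integrable_sq.convolution_integrand (ContinuousLinearMap.mul ℝ ℝ) hk.comp_neg).swap
    refine this.congr (Filter.Eventually.of_forall fun p => ?_)
    simp
  have h0 := (integrable_unitMeasure_iff.1 (integrable_of_memLp hw)).convolution_integrand
    (ContinuousLinearMap.mul ℝ ℝ) hk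
  refine (h1.add h2).mono' (h0.aestronglyMeasurable.mul hΦ.aestronglyMeasurable.comp_fst)
    (Filter.Eventually.of_forall fun p => ?_)
  have hk0 : 0 ≤ fracKernel α (p.1 - p.2) := indicator_nonneg (fun t ht =>
    div_nonneg (Real.rpow_nonneg ht.1.le _) (Real.Gamma_pos_of_pos hα).le) _
  simp only [Pi.add_apply, ContinuousLinearMap.mul_apply', norm_mul, Real.norm_eq_abs,
    abs_of_nonneg hk0]
  generalize (Ioo (0 : ℝ) 1).indicator w p.2 = a
  generalize (Ioo (0 : ℝ) 1).indicator φ p.1 = b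
  have hab : |a| * |b| ≤ a ^ 2 + b ^ 2 := by
    nlinarith [sq_abs a, sq_abs b, sq_nonneg (|a| - |b|), sq_nonneg (|a| + |b|)]
  calc |a| * fracKernel α (p.1 - p.2) * |b| = |a| * |b| * fracKernel α (p.1 - p.2) := by ring
    _ ≤ (a ^ 2 + b ^ 2) * fracKernel α (p.1 - p.2) := mul_le_mul_of_nonneg_right hab hk0
    _ = _ := by ring

/-! ### Test functions and weak derivatives -/

namespace IsTestFunction

variable {φ : ℝ → ℝ}

lemma continuous (h : IsTestFunction φ) : Continuous φ := h.1.continuous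

lemma deriv (h : IsTestFunction φ) : IsTestFunction (deriv φ) :=
  ⟨(contDiff_infty_iff_deriv.1 h.1).2, h.2.1.deriv, tsupport_deriv_subset.trans h.2.2⟩

lemma apply_eq_zero (h : IsTestFunction φ) {x : ℝ} (hx : x ∉ Ioo (0 : ℝ) 1) : φ x = 0 :=
  image_eq_zero_of_notMem_tsupport fun h' => hx (h.2.2 h')

lemma integral_deriv_eq (h : IsTestFunction φ) (a b : ℝ) :
    ∫ x in a..b, _root_.deriv φ x = φ b - φ a :=
  intervalIntegral.integral_deriv_eq_sub
    (fun x _ => (contDiff_infty_iff_deriv.1 h.1).1 x) (h.deriv.continuous.intervalIntegrable _ _)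

lemma integral_deriv (h : IsTestFunction φ) : ∫ x, _root_.deriv φ x ∂unitMeasure = 0 := by
  rw [← integral_zero_one_eq, h.integral_deriv_eq, h.apply_eq_zero (by simp),
    h.apply_eq_zero (by simp), sub_zero]

lemma integrable_mul (h : IsTestFunction φ) {w : ℝ → ℝ} (hw : Integrable w unitMeasure) :
    Integrable (fun x => w x * φ x) unitMeasure := by
  obtain ⟨C, hC⟩ := h.2.1.exists_bound_of_continuous h.continuous
  exact hw.mul_bdd h.continuous.aestronglyMeasurable (Filter.Eventually.of_forall hC)

lemma exists_primitive (h : IsTestFunction φ) (h0 : ∫ x, φ x ∂unitMeasure = 0) :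
    ∃ ψ, IsTestFunction ψ ∧ _root_.deriv ψ = φ := by
  obtain ⟨a, b, ha, hb, hab⟩ : ∃ a b : ℝ, 0 < a ∧ b < 1 ∧ tsupport φ ⊆ Icc a b := by
    rcases (tsupport φ).eq_empty_or_nonempty with he | hne
    · exact ⟨1 / 2, 1 / 2, by norm_num, by norm_num, by simp [he]⟩
    · have hK : IsCompact (tsupport φ) := h.2.1
      exact ⟨_, _, (h.2.2 (hK.sInf_mem hne)).1, (h.2.2 (hK.sSup_mem hne)).2,
        fun x hx => ⟨csInf_le hK.bddBelow hx, le_csSup hK.bddAbove hx⟩⟩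
  have hz : ∀ x, x ∉ Icc a b → φ x = 0 := fun x hx =>
    image_eq_zero_of_notMem_tsupport fun h' => hx (hab h')
  have hd : ∀ x, HasDerivAt (fun x => ∫ s in (0 : ℝ)..x, φ s) (φ x) x := fun x =>
    intervalIntegral.integral_hasDerivAt_right (h.continuous.intervalIntegrable _ _)
      h.continuous.aestronglyMeasurable.stronglyMeasurableAtFilter h.continuous.continuousAt
  have hder : _root_.deriv (fun x => ∫ s in (0 : ℝ)..x, φ s) = φ := funext fun x => (hd x).deriv
  have hsupp : Function.support (fun x => ∫ s in (0 : ℝ)..x, φ s) ⊆ Icc a b := by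
    intro x hx
    by_contra hxab
    refine hx ?_
    change ∫ s in (0 : ℝ)..x, φ s = 0
    by_cases hxa : x < a
    · rw [intervalIntegral.integral_congr (g := fun _ => 0), intervalIntegral.integral_zero]
      intro s hs
      refine hz s fun hs' => ?_
      rcases le_max_iff.1 hs.2 with h1 | h1
      · linarith [hs'.1]
      · linarith [hs'.1]
    · have hxb : b < x := by by_contra hxb; exact hxab ⟨not_lt.1 hxa, not_lt.1 hxb⟩
      have h1 : ∫ s in x..1, φ s = 0 := by
        rw [intervalIntegral.integral_congr (g := fun _ => 0), intervalIntegral.integral_zero]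
        intro s hs
        refine hz s fun hs' => ?_
        rcases min_le_iff.1 hs.1 with h1 | h1
        · linarith [hs'.2]
        · linarith [hs'.2]
      rw [← integral_zero_one_eq, ← intervalIntegral.integral_add_adjacent_intervals
        (h.continuous.intervalIntegrable 0 x) (h.continuous.intervalIntegrable x 1), h1,
        add_zero] at h0
      exact h0
  have hts := closure_minimal hsupp isClosed_Icc
  exact ⟨_, ⟨contDiff_infty_iff_deriv.2 ⟨fun x => (hd x).differentiableAt, hder.symm ▸ h.1⟩,
    HasCompactSupport.of_support_subset_isCompact isCompact_Icc hsupp,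
    hts.trans (Icc_subset_Ioo ha hb)⟩, hder⟩

end IsTestFunction

/-- Integration by parts for the absolutely continuous function `leftFracInt 1 w`. -/
lemma integral_leftFracInt_one_mul_deriv {w φ : ℝ → ℝ} (hw : Integrable w unitMeasure)
    (hφ : IsTestFunction φ) :
    ∫ x, leftFracInt 1 w x * deriv φ x ∂unitMeasure = -∫ x, w x * φ x ∂unitMeasure := by
  rw [integral_leftFracInt_mul_of_continuousOn one_pos hw hφ.deriv.continuous.continuousOn,
    ← integral_neg]
  refine integral_congr_ae ?_
  filter_upwards [ae_unitMeasure_mem] with s hs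
  have : rightFracInt 1 (deriv φ) s = -φ s := by
    simp only [rightFracInt, sub_self, Real.rpow_zero, div_one, Real.Gamma_one, one_mul]
    rw [hφ.integral_deriv_eq, hφ.apply_eq_zero (by simp), zero_sub]
  rw [this, mul_neg]

lemma ae_eq_zero_of_forall_test {w : ℝ → ℝ} (hw : Integrable w unitMeasure)
    (h : ∀ φ, IsTestFunction φ → ∫ x, w x * φ x ∂unitMeasure = 0) : w =ᵐ[unitMeasure] 0 := by
  have hloc : LocallyIntegrableOn w (Ioo (0 : ℝ) 1) volume :=
    IntegrableOn.locallyIntegrableOn hw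
  have := isOpen_Ioo.ae_eq_zero_of_integral_contDiff_smul_eq_zero hloc fun φ h1 h2 h3 => by
    rw [← h φ ⟨h1, h2, h3⟩, unitMeasure, ← integral_indicator measurableSet_Ioo]
    congr 1; ext x
    by_cases hx : x ∈ Ioo (0 : ℝ) 1
    · rw [indicator_of_mem hx, smul_eq_mul, mul_comm]
    · rw [indicator_of_notMem hx,
        image_eq_zero_of_notMem_tsupport (fun h' => hx (h3 h')), zero_smul]
  exact (ae_restrict_iff' measurableSet_Ioo).2 this

lemma ae_eq_of_forall_test {v w : ℝ → ℝ} (hv : Integrable v unitMeasure)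
    (hw : Integrable w unitMeasure) (h : ∀ φ, IsTestFunction φ →
      ∫ x, v x * φ x ∂unitMeasure = ∫ x, w x * φ x ∂unitMeasure) : v =ᵐ[unitMeasure] w := by
  have := ae_eq_zero_of_forall_test (hv.sub hw) fun φ hφ => by
    simp only [Pi.sub_apply, sub_mul]
    rw [integral_sub (hφ.integrable_mul hv) (hφ.integrable_mul hw), h φ hφ, sub_self]
  filter_upwards [this] with x hx using sub_eq_zero.1 hx

lemma exists_isTestFunction_integral_eq_one :
    ∃ φ, IsTestFunction φ ∧ ∫ x, φ x ∂unitMeasure = 1 := by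
  let b : ContDiffBump (1 / 2 : ℝ) := ⟨1 / 8, 1 / 4, by norm_num, by norm_num⟩
  have hs : tsupport (b.normed volume) ⊆ Ioo 0 1 := by
    rw [b.tsupport_normed_eq, Real.closedBall_eq_Icc]
    exact Icc_subset_Ioo (by norm_num) (by norm_num)
  refine ⟨b.normed volume, ⟨b.contDiff_normed, b.hasCompactSupport_normed, hs⟩, ?_⟩
  rw [unitMeasure, setIntegral_eq_integral_of_forall_compl_eq_zero, b.integral_normed]
  exact fun x hx => image_eq_zero_of_notMem_tsupport fun h' => hx (hs h')

/-- The lemma of du Bois-Reymond: two functions with the same distributional derivative differ by a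
constant. -/
lemma exists_ae_eq_add_const {v w : ℝ → ℝ} (hv : Integrable v unitMeasure)
    (hw : Integrable w unitMeasure) (h : ∀ φ, IsTestFunction φ →
      ∫ x, v x * deriv φ x ∂unitMeasure = ∫ x, w x * deriv φ x ∂unitMeasure) :
    ∃ c, v =ᵐ[unitMeasure] fun x => w x + c := by
  obtain ⟨φ₀, hφ₀, h1⟩ := exists_isTestFunction_integral_eq_one
  refine ⟨∫ x, (v x - w x) * φ₀ x ∂unitMeasure, ae_eq_of_forall_test hv
    (hw.add (integrable_const _)) fun φ hφ => ?_⟩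
  set c := ∫ x, (v x - w x) * φ₀ x ∂unitMeasure with hc
  set m := ∫ x, φ x ∂unitMeasure with hm
  have hφi : Integrable φ unitMeasure :=
    integrable_of_memLp (memLp_of_continuousOn hφ.continuous.continuousOn)
  have hφ₀i : Integrable φ₀ unitMeasure :=
    integrable_of_memLp (memLp_of_continuousOn hφ₀.continuous.continuousOn)
  -- subtracting a multiple of `φ₀` makes the mean vanish, so that the difference is a derivative
  have hχ : IsTestFunction fun x => φ x - m * φ₀ x :=
    ⟨hφ.1.sub (contDiff_const.mul hφ₀.1), hφ.2.1.sub hφ₀.2.1.mul_left,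
      (tsupport_sub _ _).trans (union_subset hφ.2.2
        ((tsupport_mul_subset_right (f := fun _ => m)).trans hφ₀.2.2))⟩
  obtain ⟨ψ, hψ, hψ'⟩ := hχ.exists_primitive (by
    rw [integral_sub hφi (hφ₀i.const_mul m), integral_const_mul, h1, mul_one, sub_self])
  have hz := h ψ hψ
  simp only [hψ', mul_sub] at hz
  have hcv : ∀ z : ℝ → ℝ, ∫ x, z x * (m * φ₀ x) ∂unitMeasure =
      m * ∫ x, z x * φ₀ x ∂unitMeasure := fun z => by
    rw [← integral_const_mul]; congr 1; ext x; ring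
  have hiv : ∀ z : ℝ → ℝ, Integrable z unitMeasure →
      Integrable (fun x => z x * (m * φ₀ x)) unitMeasure := fun z hz => by
    refine ((hφ₀.integrable_mul hz).const_mul m).congr (Filter.Eventually.of_forall fun x => ?_)
    simp only; ring
  rw [integral_sub (hφ.integrable_mul hv) (hiv v hv),
    integral_sub (hφ.integrable_mul hw) (hiv w hw), hcv, hcv] at hz
  have hce : c = ∫ x, v x * φ₀ x ∂unitMeasure - ∫ x, w x * φ₀ x ∂unitMeasure := by
    rw [hc, ← integral_sub (hφ₀.integrable_mul hv) (hφ₀.integrable_mul hw)]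
    simp only [sub_mul]
  simp only [add_mul]
  rw [integral_add (hφ.integrable_mul hw) (hφi.const_mul c), integral_const_mul, ← hm]
  linear_combination hz - m * hce

/-! ### Functions with a fractional derivative -/

lemma leftFracInt_one (w : ℝ → ℝ) (x : ℝ) : leftFracInt 1 w x = ∫ s in (0 : ℝ)..x, w s := by
  simp [leftFracInt]

lemma leftFracInt_const_mul (α c : ℝ) (w : ℝ → ℝ) (x : ℝ) :
    leftFracInt α (fun s => c * w s) x = c * leftFracInt α w x := by
  simp only [leftFracInt, mul_div_assoc, intervalIntegral.integral_const_mul]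
  ring

lemma leftFracInt_zero (α x : ℝ) : leftFracInt α 0 x = 0 := by simp [leftFracInt]

lemma integrable_fracKernel_unitMeasure {α : ℝ} (hα : 0 < α) :
    Integrable (fracKernel α) unitMeasure := (integrable_fracKernel hα).restrict

lemma fracKernel_one_ae_eq : fracKernel 1 =ᵐ[unitMeasure] fun _ => 1 := by
  filter_upwards [ae_unitMeasure_mem] with x hx
  simp [fracKernel_of_mem hx]

lemma leftFracInt_const {α : ℝ} (hα : 0 < α) (c : ℝ) {x : ℝ} (hx : x ∈ Ioo (0 : ℝ) 1) :
    leftFracInt α (fun _ => c) x = c * leftFracInt 1 (fracKernel α) x := by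
  rw [leftFracInt_fracKernel one_pos hα hx, add_comm, ← leftFracInt_fracKernel hα one_pos hx,
    leftFracInt_congr fracKernel_one_ae_eq (Ioo_subset_Icc_self hx), ← leftFracInt_const_mul]
  simp

/-- A function with Caputo derivative `g` is a fractional integral of `g` up to a constant. -/
lemma HasLeftCaputo.exists_ae_eq {μ : ℝ} (hμ : 0 < μ) {v g : ℝ → ℝ} (h : HasLeftCaputo μ v g)
    (hv : Integrable v unitMeasure) (hg : Integrable g unitMeasure) :
    ∃ c, v =ᵐ[unitMeasure] fun x => leftFracInt μ g x + c :=
  exists_ae_eq_add_const hv (integrable_leftFracInt hμ hg) fun φ hφ => by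
    simpa only [integral_zero_one_eq] using h φ hφ

lemma hasLeftCaputo_of_ae_eq {μ : ℝ} {v g : ℝ → ℝ} (h : v =ᵐ[unitMeasure] leftFracInt μ g) :
    HasLeftCaputo μ v g := fun φ _ => by
  simp only [integral_zero_one_eq]
  exact integral_congr_ae (h.mono fun x hx => by simp [hx])

/-- If `v` differs from `leftFracInt μ g` by the constant `c`, then its fractional integral of the
complementary order `α = 1 - μ` is absolutely continuous; the constant contributes the multiple
`c * fracKernel α` to the derivative. -/
lemma leftFracInt_ae_eq_leftFracInt_one {α μ c : ℝ} (hα : 0 < α) (hμ : 0 < μ) (hαμ : α + μ = 1)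
    {v g : ℝ → ℝ} (hg : Integrable g unitMeasure)
    (h : v =ᵐ[unitMeasure] fun x => leftFracInt μ g x + c) :
    leftFracInt α v =ᵐ[unitMeasure] leftFracInt 1 fun x => g x + c * fracKernel α x := by
  have h1 := leftFracInt_linear hα (integrable_leftFracInt hμ hg)
    (integrable_const (c := c) (μ := unitMeasure)) 1 1
  have h2 := leftFracInt_linear one_pos hg (integrable_fracKernel_unitMeasure hα) 1 c
  simp only [one_mul] at h1 h2
  filter_upwards [h1, h2, leftFracInt_leftFracInt hα hμ hg, ae_unitMeasure_mem] with x h1 h2 h3 hx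
  rw [leftFracInt_congr h (Ioo_subset_Icc_self hx), h1, h2, h3, hαμ, leftFracInt_const hα c hx]

lemma hasLeftRL_of_ae_eq {μ : ℝ} (hμ₀ : 0 < μ) (hμ₁ : μ < 1) {v g : ℝ → ℝ}
    (hg : Integrable g unitMeasure) (h : v =ᵐ[unitMeasure] leftFracInt μ g) :
    HasLeftRL μ v g := fun φ hφ => by
  have h' := leftFracInt_ae_eq_leftFracInt_one (c := 0) (sub_pos.2 hμ₁) hμ₀ (by ring) hg
    (by simpa using h)
  simp only [zero_mul, add_zero] at h'
  rw [integral_zero_one_eq, integral_zero_one_eq, ← integral_leftFracInt_one_mul_deriv hg hφ]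
  exact integral_congr_ae (h'.mono fun x hx => by simp [hx])

/-- Comparison of the two left derivatives: the Riemann–Liouville derivative sees the constant `c`
that the Caputo derivative ignores. -/
lemma HasLeftRL.ae_eq {μ c : ℝ} (hμ₀ : 0 < μ) (hμ₁ : μ < 1) {v g r : ℝ → ℝ}
    (hr : HasLeftRL μ v r) (hri : Integrable r unitMeasure) (hg : Integrable g unitMeasure)
    (h : v =ᵐ[unitMeasure] fun x => leftFracInt μ g x + c) :
    r =ᵐ[unitMeasure] fun x => g x + c * fracKernel (1 - μ) x := by
  have hG : Integrable (fun x => g x + c * fracKernel (1 - μ) x) unitMeasure :=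
    hg.add ((integrable_fracKernel_unitMeasure (sub_pos.2 hμ₁)).const_mul c)
  refine ae_eq_of_forall_test hri hG fun φ hφ => ?_
  have h1 := hr φ hφ
  rw [integral_zero_one_eq, integral_zero_one_eq] at h1
  have h2 := leftFracInt_ae_eq_leftFracInt_one (sub_pos.2 hμ₁) hμ₀ (by ring) hg h
  rw [integral_congr_ae (h2.mono fun x hx => congrArg (· * deriv φ x) hx),
    integral_leftFracInt_one_mul_deriv hG hφ] at h1
  exact neg_injective h1.symm

lemma eqOn_Icc_of_ae_eq {v w : ℝ → ℝ} (hv : ContinuousOn v (Icc 0 1))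
    (hw : ContinuousOn w (Icc 0 1)) (h : v =ᵐ[unitMeasure] w) : EqOn v w (Icc 0 1) := by
  refine Measure.eqOn_Icc_of_ae_eq volume zero_ne_one ?_ hv hw
  rwa [← Measure.restrict_congr_set Ioo_ae_eq_Icc]

lemma HasRightCaputo.eqOn {μ : ℝ} (hμ : 1 / 2 < μ) {v h : ℝ → ℝ}
    (hv : ContinuousOn v (Icc 0 1)) (hh : MemLp h 2 unitMeasure) (hvh : HasRightCaputo μ v h) :
    EqOn v (fun x => rightFracInt μ h x + v 1) (Icc 0 1) := by
  have hc := continuousOn_rightFracInt hμ hh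
  obtain ⟨c, hvc⟩ := exists_ae_eq_add_const (integrable_of_memLp (memLp_of_continuousOn hv))
    (integrable_of_memLp (memLp_of_continuousOn hc)) fun φ hφ => by
      simpa only [integral_zero_one_eq] using hvh φ hφ
  have he := eqOn_Icc_of_ae_eq hv (hc.add continuousOn_const) hvc
  have h1 : v 1 = c := by
    rw [he (right_mem_Icc.2 zero_le_one)]; simp [rightFracInt]
  rwa [h1]

lemma eq_zero_of_memLp_mul_fracKernel {α c : ℝ} (hα₀ : 0 < α) (hα : α ≤ 1 / 2)
    (h : MemLp (fun x => c * fracKernel α x) 2 unitMeasure) : c = 0 := by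
  by_contra hc
  have hk : MemLp (fracKernel α) 2 unitMeasure := by
    refine (h.const_mul c⁻¹).ae_eq (Filter.Eventually.of_forall fun x => ?_)
    field_simp
  have hΓ := (Real.Gamma_pos_of_pos hα₀).ne'
  have h2 : IntegrableOn (fun t : ℝ => t ^ (2 * α - 2)) (Ioo 0 1) volume := by
    refine (hk.integrable_sq.const_mul (Real.Gamma α ^ 2)).congr ?_
    filter_upwards [ae_unitMeasure_mem] with t ht
    rw [fracKernel_of_mem ht, div_pow, ← Real.rpow_mul_natCast ht.1.le,
      mul_div_cancel₀ _ (pow_ne_zero 2 hΓ)]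
    congr 1; push_cast; ring
  rw [intervalIntegral.integrableOn_Ioo_rpow_iff one_pos] at h2
  linarith

lemma eq_zero_of_mul_fracKernel_eqOn {α c : ℝ} (hα₀ : 0 < α) (hα₁ : α < 1) {H : ℝ → ℝ}
    (hH : ContinuousOn H (Icc 0 1)) (h : EqOn (fun x => c * fracKernel α x) H (Ioo 0 1)) :
    c = 0 := by
  have hΓ := (Real.Gamma_pos_of_pos hα₀).ne'
  have hp : ContinuousOn (fun x : ℝ => x ^ (1 - α) * H x) (Icc 0 1) :=
    (Real.continuous_rpow_const (by linarith)).continuousOn.mul hH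
  -- the continuous function `x ^ (1 - α) * H x` vanishes at `0` and is constant on `(0,1)`
  have he := eqOn_Icc_of_ae_eq hp (continuousOn_const (c := c / Real.Gamma α)) (by
    filter_upwards [ae_unitMeasure_mem] with x hx
    have hr : x ^ (1 - α) * x ^ (α - 1) = 1 := by
      rw [← Real.rpow_add hx.1]; simp
    rw [← h hx]
    beta_reduce
    rw [fracKernel_of_mem hx, mul_div_assoc', mul_div_assoc', mul_left_comm, hr, mul_one])
    (left_mem_Icc.2 zero_le_one)
  simp only [Real.zero_rpow (by linarith : 1 - α ≠ 0), zero_mul] at he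
  exact (div_eq_zero_iff.1 he.symm).resolve_right hΓ

lemma memLp_leftFracInt_of_continuousOn {α : ℝ} (hα : 0 < α) {w : ℝ → ℝ}
    (hw : ContinuousOn w (Icc 0 1)) : MemLp (leftFracInt α w) 2 unitMeasure := by
  obtain ⟨C, hC⟩ := isCompact_Icc.exists_bound_of_continuousOn hw
  have hk := integrable_fracKernel hα
  refine MemLp.of_bound (integrable_leftFracInt hα (integrable_of_memLp
    (memLp_of_continuousOn hw))).aestronglyMeasurable (∫ t, C * ‖fracKernel α t‖) ?_
  filter_upwards [ae_unitMeasure_mem] with x hx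
  rw [leftFracInt_eq_convolution (Ioo_subset_Icc_self hx), convolution,
    ← integral_sub_left_eq_self (fun t => C * ‖fracKernel α t‖) volume x]
  refine norm_integral_le_of_norm_le ((hk.norm.const_mul C).comp_sub_left x)
    (Filter.Eventually.of_forall fun s => ?_)
  simp only [ContinuousLinearMap.mul_apply', norm_mul]
  have hC0 : 0 ≤ C := (norm_nonneg _).trans (hC 0 (left_mem_Icc.2 zero_le_one))
  refine mul_le_mul_of_nonneg_right ?_ (norm_nonneg _)
  by_cases hs : s ∈ Ioo (0 : ℝ) 1
  · rw [indicator_of_mem hs]; exact hC s (Ioo_subset_Icc_self hs)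
  · rwa [indicator_of_notMem hs, norm_zero]

lemma memLp_rightFracInt_of_continuousOn {α : ℝ} (hα : 0 < α) {w : ℝ → ℝ}
    (hw : ContinuousOn w (Icc 0 1)) : MemLp (rightFracInt α w) 2 unitMeasure := by
  have hr : MapsTo (fun x : ℝ => 1 - x) (Icc 0 1) (Icc 0 1) := fun x hx =>
    ⟨by linarith [hx.2], by linarith [hx.1]⟩
  have h := (memLp_leftFracInt_of_continuousOn hα
    (hw.comp (by fun_prop) hr)).comp_measurePreserving measurePreserving_one_sub
  exact h.ae_eq (Filter.Eventually.of_forall fun x => (rightFracInt_eq_leftFracInt α w x).symm)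

/-! ### The solution -/

/-- The Riemann–Liouville derivative of order `1 - β/2` of the solution, which is also its Caputo
derivative. -/
noncomputable def neumannFlux (β : ℝ) (f : ℝ → ℝ) (a₀ : ℝ) (x : ℝ) : ℝ :=
  a₀ * fracKernel (1 - β / 2) x - leftFracInt (1 - β / 2) f x

/-- The solution of the Riemann–Liouville equation with Caputo fractional Neumann condition. -/
noncomputable def neumannSolution (β : ℝ) (f : ℝ → ℝ) (a₀ : ℝ) : ℝ → ℝ :=
  leftFracInt (1 - β / 2) (neumannFlux β f a₀)

section

variable {β a₀ a₁ : ℝ} {f : ℝ → ℝ}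

lemma memLp_neumannFlux (hβ₁ : β < 1) (hf : MemLp f 2 unitMeasure) :
    MemLp (neumannFlux β f a₀) 2 unitMeasure :=
  (((memLp_fracKernel (by linarith)).restrict _).const_mul a₀).sub
    (memLp_of_continuousOn (continuousOn_leftFracInt (by linarith) hf))

lemma continuousOn_neumannSolution (hβ₁ : β < 1) (hf : MemLp f 2 unitMeasure) :
    ContinuousOn (neumannSolution β f a₀) (Icc 0 1) :=
  continuousOn_leftFracInt (by linarith) (memLp_neumannFlux hβ₁ hf)

/-- The solution is a fractional integral of order `1 - β` of a continuous function, which is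
therefore its Caputo derivative of that order. -/
lemma neumannSolution_ae_eq (hβ₀ : 0 < β) (hβ₁ : β < 1) (hf : MemLp f 2 unitMeasure) :
    neumannSolution β f a₀ =ᵐ[unitMeasure]
      leftFracInt (1 - β) fun x => a₀ - leftFracInt 1 f x := by
  have hμ : 0 < 1 - β / 2 := by linarith
  have hfi := integrable_of_memLp hf
  have hki := integrable_of_memLp (memLp_neumannFlux (a₀ := a₀) hβ₁ hf)
  have h1 : leftFracInt (β / 2) (neumannFlux β f a₀) =ᵐ[unitMeasure]
      fun x => a₀ - leftFracInt 1 f x := by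
    have hl := leftFracInt_linear (half_pos hβ₀) (integrable_fracKernel_unitMeasure hμ)
      (integrable_leftFracInt hμ hfi) a₀ (-1)
    filter_upwards [hl, leftFracInt_leftFracInt (half_pos hβ₀) hμ hfi, fracKernel_one_ae_eq,
      ae_unitMeasure_mem] with x h1 h2 h3 hx
    have hk : neumannFlux β f a₀ =
        fun s => a₀ * fracKernel (1 - β / 2) s + -1 * leftFracInt (1 - β / 2) f s := by
      ext s; simp only [neumannFlux]; ring
    rw [hk, h1, h2, leftFracInt_fracKernel (half_pos hβ₀) hμ hx, add_sub_cancel, h3]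
    ring
  have h2 := leftFracInt_leftFracInt (sub_pos.2 hβ₁) (half_pos hβ₀) hki
  have he : 1 - β + β / 2 = 1 - β / 2 := by ring
  rw [he] at h2
  filter_upwards [h2, ae_unitMeasure_mem] with x h2 hx
  rw [← leftFracInt_congr h1 (Ioo_subset_Icc_self hx), h2, neumannSolution]

lemma memHCl_neumannSolution (hβ₁ : β < 1) (hf : MemLp f 2 unitMeasure) :
    MemHCl (1 - β / 2) (neumannSolution β f a₀) :=
  ⟨memLp_of_continuousOn (continuousOn_neumannSolution hβ₁ hf), _, memLp_neumannFlux hβ₁ hf,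
    hasLeftCaputo_of_ae_eq Filter.EventuallyEq.rfl⟩

lemma hasLeftRL_neumannSolution (hβ₀ : 0 < β) (hβ₁ : β < 1) (hf : MemLp f 2 unitMeasure) :
    HasLeftRL (1 - β / 2) (neumannSolution β f a₀) (neumannFlux β f a₀) :=
  hasLeftRL_of_ae_eq (by linarith) (by linarith) (integrable_of_memLp (memLp_neumannFlux hβ₁ hf))
    Filter.EventuallyEq.rfl

lemma memHRl_neumannSolution (hβ₀ : 0 < β) (hβ₁ : β < 1) (hf : MemLp f 2 unitMeasure) :
    MemHRl (1 - β / 2) (neumannSolution β f a₀) :=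
  ⟨memLp_of_continuousOn (continuousOn_neumannSolution hβ₁ hf), _, memLp_neumannFlux hβ₁ hf,
    hasLeftRL_neumannSolution hβ₀ hβ₁ hf⟩

lemma isDistribSolution_neumannSolution (hβ₀ : 0 < β) (hβ₁ : β < 1)
    (hf : MemLp f 2 unitMeasure) (hfa : (∫ x in (0 : ℝ)..1, f x) + a₁ - a₀ = 0) :
    IsDistribSolution β f a₀ a₁ (neumannSolution β f a₀) := by
  have hu := neumannSolution_ae_eq (a₀ := a₀) hβ₀ hβ₁ hf
  have hF : ContinuousOn (leftFracInt 1 f) (Icc 0 1) :=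
    continuousOn_leftFracInt (by norm_num) hf
  have hg : ContinuousOn (fun x => a₀ - leftFracInt 1 f x) (Icc 0 1) := continuousOn_const.sub hF
  have hFi := integrable_of_memLp (memLp_of_continuousOn hF)
  have hgi := integrable_of_memLp (memLp_of_continuousOn hg)
  refine ⟨integrable_of_memLp (memLp_of_continuousOn (continuousOn_neumannSolution hβ₁ hf)),
    fun φ hφ => ?_, _, hg, hasLeftCaputo_of_ae_eq hu, by simp [leftFracInt_one], ?_⟩
  · have h' := leftFracInt_ae_eq_leftFracInt_one (c := 0) hβ₀ (sub_pos.2 hβ₁) (by ring) hgi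
      (by simpa using hu)
    simp only [zero_mul, add_zero] at h'
    rw [integral_zero_one_eq, integral_zero_one_eq,
      integral_congr_ae (h'.mono fun x hx => congrArg (· * deriv (deriv φ) x) hx),
      integral_leftFracInt_one_mul_deriv hgi hφ.deriv, neg_neg]
    simp only [sub_mul]
    rw [integral_sub (hφ.deriv.integrable_mul (integrable_const a₀))
      (hφ.deriv.integrable_mul hFi), integral_const_mul, hφ.integral_deriv,
      integral_leftFracInt_one_mul_deriv (integrable_of_memLp hf) hφ]
    ring
  · simp only [leftFracInt_one]; linarith

/-- The Galerkin equation for the flux. Testing `-D ₀I^(β/2) (flux) = f` with `v` splits into the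
contribution `v 0 - v 1` of the kernel, the contribution `∫ f (v - v 1)` of the source, and the
compatibility condition, which replaces `a₀ - ∫ f` by `a₁`. -/
lemma neumannFlux_galerkin (hβ₁ : β < 1) (hf : MemLp f 2 unitMeasure)
    (hfa : (∫ x in (0 : ℝ)..1, f x) + a₁ - a₀ = 0) {v h : ℝ → ℝ}
    (hv : ContinuousOn v (Icc 0 1)) (hh : MemLp h 2 unitMeasure)
    (hvh : HasRightCaputo (1 - β / 2) v h) :
    -∫ x in (0 : ℝ)..1, neumannFlux β f a₀ x * h x =
      (∫ x in (0 : ℝ)..1, f x * v x) + a₁ * v 1 - a₀ * v 0 := by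
  have hμ : 1 / 2 < 1 - β / 2 := by linarith
  have he := hvh.eqOn hμ hv hh
  have hI := memLp_of_continuousOn (continuousOn_leftFracInt hμ hf)
  have hK : ∫ x, fracKernel (1 - β / 2) x * h x ∂unitMeasure = v 0 - v 1 := by
    have h0 := he (left_mem_Icc.2 zero_le_one)
    simp only at h0
    rw [h0, rightFracInt_eq_integral (left_mem_Icc.2 zero_le_one), add_sub_cancel_right,
      unitMeasure, ← integral_indicator measurableSet_Ioo]
    congr 1; ext x
    by_cases hx : x ∈ Ioo (0 : ℝ) 1
    · simp [indicator_of_mem hx]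
    · simp [indicator_of_notMem hx]
  have hF : ∫ x, leftFracInt (1 - β / 2) f x * h x ∂unitMeasure =
      ∫ x, f x * v x ∂unitMeasure - v 1 * ∫ x, f x ∂unitMeasure := by
    rw [integral_leftFracInt_mul_of_memLp (by linarith) hf hh, ← integral_const_mul,
      ← integral_sub (integrable_mul_of_memLp hf (memLp_of_continuousOn hv))
        ((integrable_of_memLp hf).const_mul _)]
    refine integral_congr_ae ?_
    filter_upwards [ae_unitMeasure_mem] with x hx
    rw [he (Ioo_subset_Icc_self hx)]
    simp only; ring
  have hsplit : ∫ x, neumannFlux β f a₀ x * h x ∂unitMeasure =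
      a₀ * ∫ x, fracKernel (1 - β / 2) x * h x ∂unitMeasure -
        ∫ x, leftFracInt (1 - β / 2) f x * h x ∂unitMeasure := by
    rw [← integral_const_mul, ← integral_sub
      ((integrable_mul_of_memLp ((memLp_fracKernel hμ).restrict _) hh).const_mul a₀)
      (integrable_mul_of_memLp hI hh)]
    congr 1; ext x; simp only [neumannFlux]; ring
  rw [integral_zero_one_eq] at hfa
  rw [integral_zero_one_eq, integral_zero_one_eq, hsplit, hK, hF]
  linear_combination (-v 1) * hfa

lemma isGalerkinSolution_neumannSolution (hβ₀ : 0 < β) (hβ₁ : β < 1)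
    (hf : MemLp f 2 unitMeasure) (hfa : (∫ x in (0 : ℝ)..1, f x) + a₁ - a₀ = 0) :
    IsGalerkinSolution β f a₀ a₁ (neumannSolution β f a₀) := by
  refine ⟨memHCl_neumannSolution hβ₁ hf, memHRl_neumannSolution hβ₀ hβ₁ hf,
    fun r hr hur v hv _ h hh hvh => ?_⟩
  have hrk := hur.ae_eq (c := 0) (by linarith) (by linarith) (integrable_of_memLp hr)
    (integrable_of_memLp (memLp_neumannFlux hβ₁ hf)) (by simp only [add_zero]; rfl)
  rw [← neumannFlux_galerkin hβ₁ hf hfa hv hh hvh, integral_zero_one_eq, integral_zero_one_eq]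
  congr 1
  exact integral_congr_ae (hrk.mono fun x hx => by simp [hx])

/-! ### Uniqueness -/

/-- A distributional solution is `₀I^(1-β) g + c`. The equation gives
`g + c * fracKernel β = b - ∫ f`; as the kernel is unbounded at `0`, `c = 0` and then `b = g 0`. -/
lemma IsDistribSolution.ae_eq (hβ₀ : 0 < β) (hβ₁ : β < 1) (hf : MemLp f 2 unitMeasure)
    {w : ℝ → ℝ} (hw : IsDistribSolution β f a₀ a₁ w) :
    w =ᵐ[unitMeasure] neumannSolution β f a₀ := by
  obtain ⟨g, hg, hwg, hg0, -⟩ := hw.boundary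
  have hgi := integrable_of_memLp (memLp_of_continuousOn hg)
  have hF : ContinuousOn (leftFracInt 1 f) (Icc 0 1) :=
    continuousOn_leftFracInt (by norm_num) hf
  have hFi := integrable_of_memLp (memLp_of_continuousOn hF)
  obtain ⟨c, hwc⟩ := hwg.exists_ae_eq (sub_pos.2 hβ₁) hw.integrable hgi
  have hI := leftFracInt_ae_eq_leftFracInt_one hβ₀ (sub_pos.2 hβ₁) (by ring) hgi hwc
  have hGi : Integrable (fun x => g x + c * fracKernel β x) unitMeasure :=
    hgi.add ((integrable_fracKernel_unitMeasure hβ₀).const_mul c)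
  obtain ⟨b, hb⟩ := exists_ae_eq_add_const hGi hFi.neg fun φ hφ => by
    have h := hw.equation φ hφ
    rw [integral_zero_one_eq, integral_zero_one_eq,
      integral_congr_ae (hI.mono fun x hx => congrArg (· * deriv (deriv φ) x) hx),
      integral_leftFracInt_one_mul_deriv hGi hφ.deriv, neg_neg] at h
    rw [h]
    simp only [Pi.neg_apply, neg_mul]
    rw [integral_neg, integral_leftFracInt_one_mul_deriv (integrable_of_memLp hf) hφ, neg_neg]
  have hH : ContinuousOn (fun x => b - leftFracInt 1 f x - g x) (Icc 0 1) :=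
    (continuousOn_const.sub hF).sub hg
  have hkc : ContinuousOn (fun x => c * fracKernel β x) (Ioo 0 1) := by
    have : ContinuousOn (fun x : ℝ => c * (x ^ (β - 1) / Real.Gamma β)) (Ioo 0 1) :=
      continuousOn_const.mul
        ((continuousOn_id.rpow_const fun x hx => Or.inl hx.1.ne').div_const _)
    exact this.congr fun x hx => by simp only [fracKernel_of_mem hx]
  have hc : c = 0 := by
    refine eq_zero_of_mul_fracKernel_eqOn hβ₀ hβ₁ hH ?_
    refine Measure.eqOn_Ioo_of_ae_eq volume ?_ hkc (hH.mono Ioo_subset_Icc_self)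
    filter_upwards [hb] with x hx
    simp only [Pi.neg_apply] at hx
    linarith
  subst hc
  have hgb : EqOn g (fun x => b - leftFracInt 1 f x) (Icc 0 1) := by
    refine eqOn_Icc_of_ae_eq hg (continuousOn_const.sub hF) ?_
    filter_upwards [hb] with x hx
    simp only [Pi.neg_apply, zero_mul] at hx
    linarith
  have hba : b = a₀ := by
    rw [← hg0, hgb (left_mem_Icc.2 zero_le_one)]; simp [leftFracInt_one]
  subst hba
  filter_upwards [hwc, neumannSolution_ae_eq (a₀ := b) hβ₀ hβ₁ hf, ae_unitMeasure_mem]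
    with x h1 h2 hx
  rw [h1, h2, add_zero]
  refine leftFracInt_congr ?_ (Ioo_subset_Icc_self hx)
  filter_upwards [ae_unitMeasure_mem] with s hs using hgb (Ioo_subset_Icc_self hs)

/-- Primitives of test functions are admissible in the Galerkin formulation. -/
lemma rightFracInt_one_admissible {μ : ℝ} (hμ₀ : 0 < μ) (hμ₁ : μ < 1) {ψ : ℝ → ℝ}
    (hψ : IsTestFunction ψ) :
    ContinuousOn (rightFracInt 1 ψ) (Icc 0 1) ∧ MemHCl μ (rightFracInt 1 ψ) ∧
      MemLp (rightFracInt (1 - μ) ψ) 2 unitMeasure ∧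
      HasRightCaputo μ (rightFracInt 1 ψ) (rightFracInt (1 - μ) ψ) := by
  have hμ' : 0 < 1 - μ := sub_pos.2 hμ₁
  have hψc : ContinuousOn ψ (Icc 0 1) := hψ.continuous.continuousOn
  have hψL := memLp_of_continuousOn hψc
  have hψi := integrable_of_memLp hψL
  have hV := continuousOn_rightFracInt (α := 1) (by norm_num) hψL
  have hl := memLp_leftFracInt_of_continuousOn hμ' hψc
  refine ⟨hV, ⟨memLp_of_continuousOn hV, fun x => -1 * leftFracInt (1 - μ) ψ x,
    hl.const_mul (-1), fun φ hφ => ?_⟩, memLp_rightFracInt_of_continuousOn hμ' hψc,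
    fun φ _ => ?_⟩
  · have h1 : rightFracInt 1 ψ = fun x => (∫ s in (0 : ℝ)..1, ψ s) + -1 * leftFracInt 1 ψ x := by
      ext x
      rw [leftFracInt_one, ← intervalIntegral.integral_add_adjacent_intervals
        (hψ.continuous.intervalIntegrable 0 x) (hψ.continuous.intervalIntegrable x 1)]
      simp [rightFracInt]
    have h2 := leftFracInt_leftFracInt hμ₀ hμ' hψi
    rw [add_sub_cancel] at h2
    have h1i := (integrable_leftFracInt one_pos hψi).const_mul (-1)
    rw [integral_zero_one_eq, integral_zero_one_eq, h1]
    simp only [add_mul, leftFracInt_const_mul]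
    rw [integral_add (hφ.deriv.integrable_mul (integrable_const _))
      (hφ.deriv.integrable_mul h1i), integral_const_mul, hφ.integral_deriv, mul_zero, zero_add]
    exact integral_congr_ae (h2.mono fun x hx => by simp [hx])
  · have h2 := rightFracInt_rightFracInt hμ₀ hμ' hψi
    rw [add_sub_cancel] at h2
    rw [integral_zero_one_eq, integral_zero_one_eq]
    exact integral_congr_ae (h2.mono fun x hx => by simp [hx])

/-- Fractional integration is injective on `L¹`. -/
lemma ae_eq_zero_of_leftFracInt_ae_eq_zero {α : ℝ} (hα₀ : 0 < α) (hα₁ : α < 1) {w : ℝ → ℝ}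
    (hw : Integrable w unitMeasure) (h : leftFracInt α w =ᵐ[unitMeasure] 0) :
    w =ᵐ[unitMeasure] 0 := by
  refine ae_eq_zero_of_forall_test hw fun φ hφ => ?_
  have h1 := leftFracInt_leftFracInt (sub_pos.2 hα₁) hα₀ hw
  rw [sub_add_cancel] at h1
  rw [← neg_eq_zero, ← integral_leftFracInt_one_mul_deriv hw hφ]
  refine integral_eq_zero_of_ae ?_
  filter_upwards [h1, ae_unitMeasure_mem] with x h1 hx
  rw [← h1, leftFracInt_congr h (Ioo_subset_Icc_self hx), leftFracInt_zero]
  simp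

/-- A Galerkin solution is `₀I^(1-β/2) p + c`, with Riemann–Liouville derivative
`p + c * fracKernel (β/2)`. The kernel is not square-integrable, so `c = 0`; testing with
primitives of test functions identifies `p`. -/
lemma IsGalerkinSolution.ae_eq (hβ₀ : 0 < β) (hβ₁ : β < 1) (hf : MemLp f 2 unitMeasure)
    (hfa : (∫ x in (0 : ℝ)..1, f x) + a₁ - a₀ = 0)
    {w : ℝ → ℝ} (hw : IsGalerkinSolution β f a₀ a₁ w) :
    w =ᵐ[unitMeasure] neumannSolution β f a₀ := by
  obtain ⟨hwL, p, hp, hwp⟩ := hw.memHCl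
  obtain ⟨-, r, hr, hwr⟩ := hw.memHRl
  have hμ₀ : 0 < 1 - β / 2 := by linarith
  have hμ₁ : 1 - β / 2 < 1 := by linarith
  have hpi := integrable_of_memLp hp
  have hk := memLp_neumannFlux (a₀ := a₀) hβ₁ hf
  obtain ⟨c, hwc⟩ := hwp.exists_ae_eq hμ₀ (integrable_of_memLp hwL) hpi
  have hrp := hwr.ae_eq hμ₀ hμ₁ (integrable_of_memLp hr) hpi hwc
  have hc : c = 0 := by
    refine eq_zero_of_memLp_mul_fracKernel (α := 1 - (1 - β / 2)) (by linarith) (by linarith)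
      ((hr.sub hp).ae_eq ?_)
    filter_upwards [hrp] with x hx
    rw [Pi.sub_apply, hx, add_sub_cancel_left]
  subst hc
  have hrk : r - neumannFlux β f a₀ =ᵐ[unitMeasure] 0 := by
    have hd := hr.sub hk
    refine ae_eq_zero_of_leftFracInt_ae_eq_zero (sub_pos.2 hμ₁) (by linarith)
      (integrable_of_memLp hd) ?_
    refine ae_eq_zero_of_forall_test (integrable_leftFracInt (sub_pos.2 hμ₁)
      (integrable_of_memLp hd)) fun ψ hψ => ?_
    obtain ⟨hV, hVC, hh, hVh⟩ := rightFracInt_one_admissible hμ₀ hμ₁ hψ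
    have h1 := hw.equation r hr hwr _ hV hVC _ hh hVh
    rw [← neumannFlux_galerkin hβ₁ hf hfa hV hh hVh, integral_zero_one_eq,
      integral_zero_one_eq] at h1
    rw [integral_leftFracInt_mul_of_continuousOn (sub_pos.2 hμ₁) (integrable_of_memLp hd)
      hψ.continuous.continuousOn]
    simp only [Pi.sub_apply, sub_mul]
    rw [integral_sub (integrable_mul_of_memLp hr hh) (integrable_mul_of_memLp hk hh),
      neg_injective h1, sub_self]
  filter_upwards [hwc, ae_unitMeasure_mem] with x h1 hx
  rw [h1, add_zero, neumannSolution]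
  refine leftFracInt_congr ?_ (Ioo_subset_Icc_self hx)
  filter_upwards [hrk, hrp] with s h2 h3
  rw [Pi.sub_apply, h3] at h2
  simpa [sub_eq_zero] using h2

end

end FracNeumann

theorem mainTheorem8 (β : ℝ) (hβ₀ : 0 < β) (hβ₁ : β < 1) (f : ℝ → ℝ)
    (hf : MemLp f 2 FracNeumann.unitMeasure) (a₀ a₁ : ℝ)
    (hfa : (∫ x in (0 : ℝ)..1, f x) + a₁ - a₀ = 0) :
    ∃ u : ℝ → ℝ,
      FracNeumann.MemHCl (1 - β / 2) u ∧ FracNeumann.MemHRl (1 - β / 2) u ∧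
      ContinuousOn u (Icc 0 1) ∧ u 0 = 0 ∧
      FracNeumann.IsDistribSolution β f a₀ a₁ u ∧
      FracNeumann.IsGalerkinSolution β f a₀ a₁ u ∧
      (∀ w : ℝ → ℝ, FracNeumann.IsDistribSolution β f a₀ a₁ w →
        w =ᵐ[FracNeumann.unitMeasure] u) ∧
      (∀ w : ℝ → ℝ, FracNeumann.IsGalerkinSolution β f a₀ a₁ w →
        w =ᵐ[FracNeumann.unitMeasure] u) :=
  ⟨FracNeumann.neumannSolution β f a₀, FracNeumann.memHCl_neumannSolution hβ₁ hf,
    FracNeumann.memHRl_neumannSolution hβ₀ hβ₁ hf,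
    FracNeumann.continuousOn_neumannSolution hβ₁ hf,
    by simp [FracNeumann.neumannSolution, FracNeumann.leftFracInt],
    FracNeumann.isDistribSolution_neumannSolution hβ₀ hβ₁ hf hfa,
    FracNeumann.isGalerkinSolution_neumannSolution hβ₀ hβ₁ hf hfa,
    fun _ hw => hw.ae_eq hβ₀ hβ₁ hf, fun _ hw => hw.ae_eq hβ₀ hβ₁ hf hfa⟩
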